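/- Let $X$ be a (real or complex) Banach space, let $A_0:\operatorname{dom}A_0\subset X\to X$ be the generator of a strongly continuous group $(e^{tA_0})_{t\in\mathbb R}$ of isometries of $X$, and let $A_1:\mathbb R\to B(X)$ be norm-continuous. Suppose that the strong limit $$A_1(0)^\natural=\operatorname*{s-lim}_{T\to\infty}\frac1T\int_0^T e^{tA_0}A_1(0)e^{-tA_0}\,dt\in B(X)$$ exists. For $\varepsilon\in\mathbb R$ let $A(\varepsilon)=A_0+\varepsilon A_1(\varepsilon)$, with domain $\operatorname{dom}A_0$. Then each $A(\varepsilon)$ generates a unique strongly continuous group $(e^{tA(\varepsilon)})_{t\in\mathbb R}$ of bounded operators on $X$, and $$\lim_{\varepsilon\downarrow 0}\ \sup_{s\in[0,s_0]}\bigl\|\bigl(e^{sA(\varepsilon)/\varepsilon}e^{-sA_0/\varepsilon}-e^{sA_1(0)^\natural}\bigr)x\bigr\|=0$$ for every $s_0>0$ and every $x\in X$. -/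

import Mathlib

open Filter Topology
open scoped ENNReal

/-- A strongly continuous one-parameter group of bounded linear operators on `X`. -/
structure IsStronglyContinuousGroup {𝕜 X : Type*} [RCLike 𝕜] [NormedAddCommGroup X]
    [NormedSpace 𝕜 X] (U : ℝ → X →L[𝕜] X) : Prop where
  map_zero : U 0 = ContinuousLinearMap.id 𝕜 X
  map_add : ∀ s t : ℝ, U (s + t) = (U s).comp (U t)
  continuous_apply : ∀ x : X, Continuous fun t : ℝ => U t x

/-- The (in general unbounded) operator `A` is the generator of the one-parameter family `U`:
`x ∈ dom A` and `A x = y` if and only if `(U h x - x) / h → y` as `h → 0`. -/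
def IsGeneratorOf {𝕜 X : Type*} [RCLike 𝕜] [NormedAddCommGroup X] [NormedSpace 𝕜 X]
    [NormedSpace ℝ X] (A : X →ₗ.[𝕜] X) (U : ℝ → X →L[𝕜] X) : Prop :=
  ∀ x y : X, (x, y) ∈ A.graph ↔
    Tendsto (fun h : ℝ => h⁻¹ • (U h x - x)) (𝓝[≠] 0) (𝓝 y)

/-- `A` generates the strongly continuous group `U`, that is, `U t = e^{tA}` for all real `t`. -/
def GeneratesGroup {𝕜 X : Type*} [RCLike 𝕜] [NormedAddCommGroup X] [NormedSpace 𝕜 X]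
    [NormedSpace ℝ X] (A : X →ₗ.[𝕜] X) (U : ℝ → X →L[𝕜] X) : Prop :=
  IsStronglyContinuousGroup U ∧ IsGeneratorOf A U

/-- The operator `A₀ + ε B` with domain `dom A₀`, for a bounded operator `B`. -/
noncomputable def perturbedOperator {𝕜 X : Type*} [RCLike 𝕜] [NormedAddCommGroup X]
    [NormedSpace 𝕜 X] (A₀ : X →ₗ.[𝕜] X) (ε : ℝ) (B : X →L[𝕜] X) : X →ₗ.[𝕜] X :=
  (((ε : 𝕜) • B : X →L[𝕜] X) : X →ₗ[𝕜] X) +ᵥ A₀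

/-- `L` is the spectral average of `B` with respect to the group `U`: the strong limit, as
`T → ∞`, of `T⁻¹ ∫₀ᵀ U(t) B U(-t) dt`. -/
def IsSpectralAverage {𝕜 X : Type*} [RCLike 𝕜] [NormedAddCommGroup X] [NormedSpace 𝕜 X]
    [NormedSpace ℝ X] (U : ℝ → X →L[𝕜] X) (B L : X →L[𝕜] X) : Prop :=
  ∀ x : X, Tendsto (fun T : ℝ => T⁻¹ • ∫ t in (0 : ℝ)..T, U t (B (U (-t) x)))
    atTop (𝓝 (L x))

/-!
Write `C(t) = U(-t) B U(t)` with `B = ε A₁(ε)`. Passing to the interaction picture turns the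
unbounded evolution equation for `A₀ + B` into `Y' = C(t) Y`, whose coefficients are bounded (as
`U` is isometric) and strongly continuous. It has a global solution by a contraction argument in a
weighted space of bounded continuous functions (`exists_linear_evolution`), and `V(t) = U(t) Y(t)`
is the group generated by `A₀ + B` (`exists_generatesGroup_perturbedOperator`). A generator is
densely defined and determines its group (`GeneratesGroup.dense_domain`, `GeneratesGroup.unique`),
so every family `V` in the statement is of this form.

For the limit, it is convenient to look at the inverse of `W(s) = V(s/ε) U(-s/ε)`, which is
`Z(s) = U(s/ε) V(-s/ε) = Y(-s/ε)`. It satisfies `Z' = -C_ε(s) Z` on all of `X`, with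
`C_ε(s) = U(s/ε) A₁(ε) U(-s/ε)` bounded uniformly in `ε`. The hypothesis on the spectral average
says that `∫₀ˢ C_ε → s L` strongly, uniformly on `[0, s₀]`, and the averaging principle
`eventually_norm_sub_exp_le` gives `Z(s) y → e^{-sL} y`, uniformly on `[0, s₀]`. Its proof is an
integration by parts followed by Grönwall's inequality. Finally
`W(s) - e^{sL} = W(s) (e^{-sL} - Z(s)) e^{sL}`, where `W` is bounded and the convergence of `Z` is
uniform on the compact set `{e^{sL} x : s ∈ [0, s₀]}` (`eventually_forall_norm_le_of_isCompact`).
-/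

/-! ### Strongly continuous families of operators -/

section StrongCalculus

variable {𝕜 X : Type*} [RCLike 𝕜] [NormedAddCommGroup X] [NormedSpace 𝕜 X]

theorem tendsto_clm_apply_of_eventually_norm_le {ι : Type*} {l : Filter ι} {W : ι → X →L[𝕜] X}
    {y : ι → X} {a b : X} {K : ℝ} (hK : ∀ᶠ s in l, ‖W s‖ ≤ K)
    (hW : Tendsto (fun s => W s a) l (𝓝 b)) (hy : Tendsto y l (𝓝 a)) :
    Tendsto (fun s => W s (y s)) l (𝓝 b) := by
  have h0 : Tendsto (fun s => W s (y s - a)) l (𝓝 0) := by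
    refine squeeze_zero_norm' (a := fun s => K * ‖y s - a‖) ?_ ?_
    · filter_upwards [hK] with s hs
      exact ((W s).le_opNorm _).trans (by gcongr)
    · simpa using ((tendsto_sub_nhds_zero_iff.2 hy).norm).const_mul K
  simpa using h0.add hW

theorem continuous_clm_apply_of_norm_le {W : ℝ → X →L[𝕜] X} {y : ℝ → X} {K : ℝ}
    (hK : ∀ s, ‖W s‖ ≤ K) (hW : ∀ x, Continuous fun s => W s x) (hy : Continuous y) :
    Continuous fun s => W s (y s) :=
  continuous_iff_continuousAt.2 fun t => tendsto_clm_apply_of_eventually_norm_le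
    (Eventually.of_forall hK) (hW (y t)).continuousAt hy.continuousAt

variable [NormedSpace ℝ X] [IsScalarTower ℝ 𝕜 X]

/-- The product rule for `s ↦ W s (y s)`, where `W` is only strongly differentiable (at the single
vector `y t`) and locally bounded. -/
theorem hasDerivAt_clm_apply_of_eventually_norm_le {W : ℝ → X →L[𝕜] X} {y : ℝ → X} {y' w' : X}
    {t K : ℝ} (hK : ∀ᶠ s in 𝓝 t, ‖W s‖ ≤ K) (hW : HasDerivAt (fun s => W s (y t)) w' t)
    (hWc : ContinuousAt (fun s => W s y') t) (hy : HasDerivAt y y' t) :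
    HasDerivAt (fun s => W s (y s)) (w' + W t y') t := by
  rw [hasDerivAt_iff_tendsto_slope] at *
  have h1 : Tendsto (fun s => W s (slope y t s)) (𝓝[≠] t) (𝓝 (W t y')) :=
    tendsto_clm_apply_of_eventually_norm_le (hK.filter_mono nhdsWithin_le_nhds)
      (hWc.tendsto.mono_left nhdsWithin_le_nhds) hy
  refine (hW.add h1).congr fun s => ?_
  simp only [slope_def_module, map_sub, ContinuousLinearMap.map_smul_of_tower, ← smul_add]
  congr 1
  abel

end StrongCalculus

/-! ### Linear evolution equations with strongly continuous bounded coefficients -/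

section LinearODE

variable {𝕜 X : Type*} [RCLike 𝕜] [NormedAddCommGroup X] [NormedSpace 𝕜 X]
  [NormedSpace ℝ X]

theorem norm_le_exp_of_hasDerivAt {C : ℝ → X →L[𝕜] X} {M : ℝ} (hM : ∀ t, ‖C t‖ ≤ M)
    {y : ℝ → X} (hy : ∀ t, HasDerivAt y (C t (y t)) t) {t : ℝ} (ht : 0 ≤ t) :
    ‖y t‖ ≤ ‖y 0‖ * Real.exp (M * t) := by
  have := norm_le_gronwallBound_of_norm_deriv_right_le (f := y) (f' := fun t => C t (y t))
    (δ := ‖y 0‖) (K := M) (ε := 0) (a := 0) (b := t)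
    (fun s _ => (hy s).continuousAt.continuousWithinAt) (fun s _ => (hy s).hasDerivWithinAt) le_rfl
    (fun s _ => by simpa using (C s).le_of_opNorm_le (hM s) (y s)) t ⟨ht, le_rfl⟩
  simpa [gronwallBound_ε0] using this

theorem norm_le_exp_abs_of_hasDerivAt {C : ℝ → X →L[𝕜] X} {M : ℝ} (hM : ∀ t, ‖C t‖ ≤ M)
    {y : ℝ → X} (hy : ∀ t, HasDerivAt y (C t (y t)) t) (t : ℝ) :
    ‖y t‖ ≤ ‖y 0‖ * Real.exp (M * |t|) := by
  rcases le_total 0 t with ht | ht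
  · simpa [abs_of_nonneg ht] using norm_le_exp_of_hasDerivAt hM hy ht
  · have h : ∀ s, HasDerivAt (fun s => y (-s)) ((-C (-s)) (y (-s))) s := fun s => by
      simpa [Function.comp_def] using (hy (-s)).scomp s (hasDerivAt_neg s)
    simpa [abs_of_nonpos ht] using norm_le_exp_of_hasDerivAt (C := fun s => -C (-s)) (M := M)
      (fun s => by simpa using hM (-s)) h (neg_nonneg.2 ht)

theorem eq_of_hasDerivAt_clm {C : ℝ → X →L[𝕜] X} {M : ℝ} (hM : ∀ t, ‖C t‖ ≤ M)
    {y z : ℝ → X} (hy : ∀ t, HasDerivAt y (C t (y t)) t) (hz : ∀ t, HasDerivAt z (C t (z t)) t)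
    (h0 : y 0 = z 0) : y = z := by
  funext t
  have := norm_le_exp_abs_of_hasDerivAt hM (y := y - z)
    (fun s => by simpa using (hy s).sub (hz s)) t
  simpa [h0, sub_eq_zero] using this

theorem norm_integral_le_of_norm_le_exp {g : ℝ → X} {K a : ℝ} (ha : 0 < a) (hK : 0 ≤ K)
    (hg : ∀ s, ‖g s‖ ≤ K * Real.exp (a * |s|)) (t : ℝ) :
    ‖∫ s in (0 : ℝ)..t, g s‖ ≤ K / a * Real.exp (a * |t|) := by
  have key : ∀ g : ℝ → X, (∀ s, ‖g s‖ ≤ K * Real.exp (a * |s|)) → ∀ t : ℝ, 0 ≤ t →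
      ‖∫ s in (0 : ℝ)..t, g s‖ ≤ K / a * Real.exp (a * t) := by
    intro g hg t ht
    have h1 : ‖∫ s in (0 : ℝ)..t, g s‖ ≤ ∫ s in (0 : ℝ)..t, K * Real.exp (a * s) := by
      refine intervalIntegral.norm_integral_le_of_norm_le ht ?_ ?_
      · filter_upwards with s hs
        simpa [abs_of_pos hs.1] using hg s
      · exact Continuous.intervalIntegrable (by fun_prop) _ _
    have h2 : ∫ s in (0 : ℝ)..t, K * Real.exp (a * s)
        = K / a * Real.exp (a * t) - K / a * Real.exp (a * 0) := by
      refine intervalIntegral.integral_eq_sub_of_hasDerivAt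
        (f := fun s => K / a * Real.exp (a * s)) (fun s _ => ?_)
        (Continuous.intervalIntegrable (by fun_prop) _ _)
      exact ((((hasDerivAt_id' s).const_mul a).exp).const_mul (K / a)).congr_deriv
        (by field_simp)
    rw [h2] at h1
    have : 0 ≤ K / a * Real.exp (a * 0) := by positivity
    linarith
  rcases le_total 0 t with ht | ht
  · simpa [abs_of_nonneg ht] using key g hg t ht
  · have h := key (fun s => g (-s)) (fun s => by simpa using hg (-s)) (-t) (neg_nonneg.2 ht)
    rw [intervalIntegral.integral_comp_neg (fun s => g s), intervalIntegral.integral_symm,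
      norm_neg] at h
    simpa [abs_of_nonpos ht] using h

variable [CompleteSpace X]

/-- The initial value problem `y' = C(t) y`, `y(0) = x` has a global solution: after the
substitution `y(t) = e^{(M+1)|t|} z(t)`, its integral form is a contraction on bounded continuous
functions. -/
theorem exists_hasDerivAt_clm {C : ℝ → X →L[𝕜] X} {M : ℝ} (hM : ∀ t, ‖C t‖ ≤ M)
    (hC : ∀ x, Continuous fun t => C t x) (x : X) :
    ∃ y : ℝ → X, y 0 = x ∧ ∀ t, HasDerivAt y (C t (y t)) t := by
  have hM0 : 0 ≤ M := (norm_nonneg _).trans (hM 0)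
  set a : ℝ := M + 1 with ha_def
  have ha : 0 < a := by positivity
  let E := BoundedContinuousFunction ℝ X
  let g : E → ℝ → X := fun z s => C s (Real.exp (a * |s|) • z s)
  have hg : ∀ z, Continuous (g z) := fun z =>
    continuous_clm_apply_of_norm_le hM hC (by have := z.continuous; fun_prop)
  have hgn : ∀ (z w : E) s, ‖g z s - g w s‖ ≤ M * ‖z - w‖ * Real.exp (a * |s|) := fun z w s => by
    simp only [g, ← map_sub, ← smul_sub]
    refine ((C s).le_of_opNorm_le (hM s) _).trans ?_
    rw [norm_smul, Real.norm_of_nonneg (Real.exp_nonneg _), mul_assoc, mul_comm (Real.exp _)]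
    gcongr
    exact (z - w).norm_coe_le_norm s
  have hint : ∀ (z w : E) t, ‖(∫ s in (0 : ℝ)..t, g z s) - ∫ s in (0 : ℝ)..t, g w s‖
      ≤ M * ‖z - w‖ / a * Real.exp (a * |t|) := fun z w t => by
    rw [← intervalIntegral.integral_sub ((hg z).intervalIntegrable _ _)
      ((hg w).intervalIntegrable _ _)]
    exact norm_integral_le_of_norm_le_exp ha (by positivity) (hgn z w) t
  have hcont : ∀ z : E, Continuous fun t => ∫ s in (0 : ℝ)..t, g z s := fun z =>
    continuous_iff_continuousAt.2 fun t =>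
      ((hg z).integral_hasStrictDerivAt 0 t).hasDerivAt.continuousAt
  let P : E → E := fun z => BoundedContinuousFunction.ofNormedAddCommGroup
    (fun t => Real.exp (-(a * |t|)) • (x + ∫ s in (0 : ℝ)..t, g z s))
    (by have := hcont z; fun_prop) (‖x‖ + M * ‖z‖ / a) (fun t => by
      rw [norm_smul, Real.norm_of_nonneg (Real.exp_nonneg _), Real.exp_neg,
        inv_mul_le_iff₀ (Real.exp_pos _)]
      have h1 := hint z 0 t
      have h2 : ∀ s, g 0 s = 0 := fun s => by
        change C s (_ • (0 : X)) = 0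
        simp
      have h3 : 1 ≤ Real.exp (a * |t|) := Real.one_le_exp (by positivity)
      simp only [h2, intervalIntegral.integral_zero, sub_zero] at h1
      calc _ ≤ ‖x‖ + _ := norm_add_le _ _
        _ ≤ Real.exp (a * |t|) * ‖x‖ + M * ‖z‖ / a * Real.exp (a * |t|) :=
          add_le_add (le_mul_of_one_le_left (norm_nonneg _) h3) h1
        _ = _ := by ring)
  have hP : ContractingWith (M / a).toNNReal P := by
    refine ⟨?_, LipschitzWith.of_dist_le_mul fun z w => ?_⟩
    · rw [Real.toNNReal_lt_one, div_lt_one ha]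
      linarith
    · rw [Real.coe_toNNReal _ (by positivity), BoundedContinuousFunction.dist_le (by positivity)]
      intro t
      simp only [P, BoundedContinuousFunction.coe_ofNormedAddCommGroup]
      rw [dist_eq_norm, ← smul_sub, add_sub_add_left_eq_sub, norm_smul,
        Real.norm_of_nonneg (Real.exp_nonneg _), Real.exp_neg, inv_mul_le_iff₀ (Real.exp_pos _)]
      refine (hint z w t).trans (le_of_eq ?_)
      rw [dist_eq_norm]
      ring
  obtain ⟨z, hz, -⟩ := hP.exists_fixedPoint 0 (edist_ne_top _ _)
  have hzt : ∀ t, Real.exp (a * |t|) • z t = x + ∫ s in (0 : ℝ)..t, g z s := fun t => by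
    have h : z t = Real.exp (-(a * |t|)) • (x + ∫ s in (0 : ℝ)..t, g z s) :=
      (DFunLike.congr_fun hz t).symm
    rw [h, smul_smul, ← Real.exp_add, add_neg_cancel, Real.exp_zero, one_smul]
  refine ⟨fun t => Real.exp (a * |t|) • z t, by simpa using hzt 0, fun t => ?_⟩
  exact (((hg z).integral_hasStrictDerivAt 0 t).hasDerivAt.const_add x).congr_of_eventuallyEq
    (Eventually.of_forall hzt)

variable [IsScalarTower ℝ 𝕜 X]

theorem exists_linear_evolution {C : ℝ → X →L[𝕜] X} {M : ℝ} (hM : ∀ t, ‖C t‖ ≤ M)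
    (hC : ∀ x, Continuous fun t => C t x) :
    ∃ Y : ℝ → X →L[𝕜] X, (∀ x, Y 0 x = x) ∧
      ∀ x t, HasDerivAt (fun s => Y s x) (C t (Y t x)) t := by
  choose y hy0 hy using exists_hasDerivAt_clm hM hC
  have hadd : ∀ x₁ x₂, y (x₁ + x₂) = y x₁ + y x₂ := fun x₁ x₂ =>
    eq_of_hasDerivAt_clm hM (hy _) (fun t => by simpa using (hy x₁ t).add (hy x₂ t))
      (by simp [hy0])
  have : SMulCommClass ℝ 𝕜 X := IsScalarTower.to_smulCommClass
  have hsmul : ∀ (c : 𝕜) x, y (c • x) = c • y x := fun c x =>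
    eq_of_hasDerivAt_clm hM (hy _) (fun t => by simpa using (hy x t).const_smul c)
      (by simp [hy0])
  refine ⟨fun t => LinearMap.mkContinuous
    { toFun := fun x => y x t
      map_add' := fun a b => congrFun (hadd a b) t
      map_smul' := fun c a => congrFun (hsmul c a) t } (Real.exp (M * |t|)) fun x => ?_,
    hy0, hy⟩
  have := norm_le_exp_abs_of_hasDerivAt hM (hy x) t
  rwa [hy0, mul_comm] at this

end LinearODE

/-! ### Strongly continuous groups and their generators -/

section Groups

variable {𝕜 X : Type*} [RCLike 𝕜] [NormedAddCommGroup X] [NormedSpace 𝕜 X]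

namespace IsStronglyContinuousGroup

variable {U : ℝ → X →L[𝕜] X}

theorem apply_zero (hU : IsStronglyContinuousGroup U) (x : X) : U 0 x = x := by
  simp [hU.map_zero]

theorem apply_add (hU : IsStronglyContinuousGroup U) (s t : ℝ) (x : X) :
    U (s + t) x = U s (U t x) := by
  simp [hU.map_add]

theorem apply_neg_apply (hU : IsStronglyContinuousGroup U) (t : ℝ) (x : X) :
    U (-t) (U t x) = x := by
  rw [← hU.apply_add, neg_add_cancel, hU.apply_zero]

theorem apply_apply_neg (hU : IsStronglyContinuousGroup U) (t : ℝ) (x : X) :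
    U t (U (-t) x) = x := by
  rw [← hU.apply_add, add_neg_cancel, hU.apply_zero]

/-- Strong continuity gives local boundedness, by the uniform boundedness principle. -/
theorem exists_eventually_norm_le [CompleteSpace X] (hU : IsStronglyContinuousGroup U) (t : ℝ) :
    ∃ K, ∀ᶠ s in 𝓝 t, ‖U s‖ ≤ K := by
  obtain ⟨K, hK⟩ := banach_steinhaus (g := fun s : Set.Icc (t - 1) (t + 1) => U s) fun x => by
    obtain ⟨c, hc⟩ := (isCompact_Icc (a := t - 1) (b := t + 1)).exists_bound_of_continuousOn
      (hU.continuous_apply x).continuousOn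
    exact ⟨c, fun s => hc s s.2⟩
  exact ⟨K, eventually_of_mem (Icc_mem_nhds (by linarith) (by linarith)) fun s hs => hK ⟨s, hs⟩⟩

end IsStronglyContinuousGroup

namespace GeneratesGroup

variable [NormedSpace ℝ X] [IsScalarTower ℝ 𝕜 X] {A : X →ₗ.[𝕜] X} {U V : ℝ → X →L[𝕜] X}

theorem mem_graph_apply (hU : GeneratesGroup A U) {x y : X} (h : (x, y) ∈ A.graph) (t : ℝ) :
    (U t x, U t y) ∈ A.graph := by
  rw [hU.2] at h ⊢
  refine (((U t).continuous.tendsto y).comp h).congr fun s => ?_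
  simp only [Function.comp_apply, ContinuousLinearMap.map_smul_of_tower, map_sub]
  rw [← hU.1.apply_add, ← hU.1.apply_add, add_comm]

theorem hasDerivAt (hU : GeneratesGroup A U) {x y : X} (h : (x, y) ∈ A.graph) (t : ℝ) :
    HasDerivAt (fun s => U s x) (U t y) t := by
  have h := hU.mem_graph_apply h t
  rw [hU.2] at h
  rw [hasDerivAt_iff_tendsto_slope_zero]
  refine h.congr fun s => ?_
  rw [add_comm t, hU.1.apply_add]

variable [CompleteSpace X]

/-- The generator is densely defined: `h⁻¹ ∫₀ʰ U(s) x ds` lies in its domain and tends to `x`. -/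
theorem dense_domain (hU : GeneratesGroup A U) : Dense (A.domain : Set X) := by
  intro x
  have hc := hU.1.continuous_apply x
  have hd : ∀ t, HasDerivAt (fun t => ∫ s in (0 : ℝ)..t, U s x) (U t x) t := fun t =>
    (hc.integral_hasStrictDerivAt 0 t).hasDerivAt
  have hmem : ∀ h : ℝ, (∫ s in (0 : ℝ)..h, U s x) ∈ A.domain := fun h => by
    refine LinearPMap.mem_domain_iff.2 ⟨U h x - U 0 x, ?_⟩
    rw [hU.2]
    have h1 := (((hd h).scomp_of_eq (0 : ℝ) ((hasDerivAt_id' (0 : ℝ)).add_const h)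
      (by simp)).sub (hd 0))
    rw [one_smul, hasDerivAt_iff_tendsto_slope_zero] at h1
    refine h1.congr fun k => ?_
    have e : U k (∫ s in (0 : ℝ)..h, U s x) = ∫ s in k..(k + h), U s x := by
      rw [← ContinuousLinearMap.intervalIntegral_comp_comm _ (hc.intervalIntegrable _ _)]
      simp_rw [← hU.1.apply_add]
      simp [intervalIntegral.integral_comp_add_left (fun s => U s x) k]
    have hI : ∀ a b, IntervalIntegrable (fun s => U s x) MeasureTheory.volume a b := fun a b =>
      hc.intervalIntegrable a b
    rw [e, ← intervalIntegral.integral_interval_sub_left (hI 0 (k + h)) (hI 0 k)]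
    simp only [Pi.sub_apply, Function.comp_apply, zero_add, intervalIntegral.integral_same,
      sub_zero]
  have h0 := hd 0
  rw [hasDerivAt_iff_tendsto_slope_zero, hU.1.apply_zero] at h0
  refine mem_closure_of_tendsto h0 (Eventually.of_forall fun t => ?_)
  simp only [zero_add, intervalIntegral.integral_same, sub_zero]
  rw [← algebraMap_smul 𝕜 t⁻¹]
  exact A.domain.smul_mem _ (hmem t)

/-- A generator determines its group: for `x` in the domain, `V(-s) U(s) x` has zero derivative. -/
theorem unique (hU : GeneratesGroup A U) (hV : GeneratesGroup A V) : U = V := by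
  have key : ∀ x ∈ A.domain, ∀ t, U t x = V t x := by
    intro x hx t
    obtain ⟨y, hxy⟩ := LinearPMap.mem_domain_iff.1 hx
    have hd : ∀ s, HasDerivAt (fun s => V (-s) (U s x)) 0 s := fun s => by
      obtain ⟨K, hK⟩ := hV.1.exists_eventually_norm_le (-s)
      have h1 : HasDerivAt (fun r => V (-r) (U s x)) (-V (-s) (U s y)) s := by
        simpa [Function.comp_def] using
          (hV.hasDerivAt (hU.mem_graph_apply hxy s) (-s)).scomp s (hasDerivAt_neg s)
      have h2 := hasDerivAt_clm_apply_of_eventually_norm_le (W := fun s => V (-s))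
        ((continuous_neg.tendsto s).eventually hK) h1
        ((hV.1.continuous_apply _).comp continuous_neg).continuousAt (hU.hasDerivAt hxy s)
      simpa using h2
    have h3 := is_const_of_deriv_eq_zero (fun s => (hd s).differentiableAt)
      (fun s => (hd s).deriv) t 0
    simp only [neg_zero, hV.1.apply_zero, hU.1.apply_zero] at h3
    rw [← hV.1.apply_apply_neg t (U t x), h3]
  funext t
  exact DFunLike.coe_injective
    (Continuous.ext_on hU.dense_domain (U t).continuous (V t).continuous fun x hx => key x hx t)

end GeneratesGroup

/-! ### Bounded perturbations of the generator of a group of isometries -/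

theorem mem_graph_perturbedOperator {A : X →ₗ.[𝕜] X} {ε : ℝ} {B : X →L[𝕜] X} {x y : X} :
    (x, y) ∈ (perturbedOperator A ε B).graph ↔ (x, y - (ε : 𝕜) • B x) ∈ A.graph := by
  simp only [LinearPMap.mem_graph_iff, perturbedOperator]
  constructor
  · rintro ⟨⟨z, hz⟩, rfl, h2⟩
    refine ⟨⟨z, hz⟩, rfl, ?_⟩
    rw [LinearPMap.vadd_apply] at h2
    rw [← h2]
    simp
  · rintro ⟨⟨z, hz⟩, rfl, h2⟩
    refine ⟨⟨z, hz⟩, rfl, ?_⟩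
    rw [LinearPMap.vadd_apply]
    change (ε : 𝕜) • B z + A ⟨z, hz⟩ = y
    rw [h2]
    simp

theorem norm_conj_le {U : ℝ → X →L[𝕜] X} (hiso : ∀ t, Isometry (U t)) (B : X →L[𝕜] X)
    (s t : ℝ) : ‖(U s).comp (B.comp (U t))‖ ≤ ‖B‖ := by
  refine ContinuousLinearMap.opNorm_le_bound _ (norm_nonneg _) fun x => ?_
  have h : ∀ t x, ‖U t x‖ = ‖x‖ := fun t x => (hiso t).norm_map_of_map_zero (map_zero _) x
  simpa [h] using B.le_opNorm (U t x)

theorem continuous_isometry_apply {U : ℝ → X →L[𝕜] X} (hU : IsStronglyContinuousGroup U)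
    (hiso : ∀ t, Isometry (U t)) {a : ℝ → ℝ} (ha : Continuous a) {y : ℝ → X}
    (hy : Continuous y) : Continuous fun s => U (a s) (y s) :=
  continuous_clm_apply_of_norm_le (K := 1) (fun s => ContinuousLinearMap.opNorm_le_bound _
    zero_le_one fun x => by
      rw [one_mul, (hiso (a s)).norm_map_of_map_zero (map_zero _) x])
    (fun x => (hU.continuous_apply x).comp ha) hy

theorem continuous_conj_apply {U : ℝ → X →L[𝕜] X} (hU : IsStronglyContinuousGroup U)
    (hiso : ∀ t, Isometry (U t)) (B : X →L[𝕜] X) {a b : ℝ → ℝ} (ha : Continuous a)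
    (hb : Continuous b) (x : X) : Continuous fun s => U (a s) (B (U (b s) x)) :=
  continuous_isometry_apply hU hiso ha (B.continuous.comp ((hU.continuous_apply x).comp hb))

variable [NormedSpace ℝ X] [IsScalarTower ℝ 𝕜 X] [CompleteSpace X]

/-- If `A` generates a group `U` of isometries and `B` is bounded, then `A + εB` generates a group
`V`; moreover `U(-t) V(t)` is strongly differentiable on all of `X`. The group is constructed in
this interaction picture, where the evolution equation has bounded coefficients. -/
theorem exists_generatesGroup_perturbedOperator {A : X →ₗ.[𝕜] X} {U : ℝ → X →L[𝕜] X}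
    (hU : GeneratesGroup A U) (hiso : ∀ t, Isometry (U t)) (ε : ℝ) (B : X →L[𝕜] X) :
    ∃ V : ℝ → X →L[𝕜] X, GeneratesGroup (perturbedOperator A ε B) V ∧
      ∀ x t, HasDerivAt (fun s => U (-s) (V s x)) ((ε : 𝕜) • U (-t) (B (V t x))) t := by
  set C : ℝ → X →L[𝕜] X := fun t => (U (-t)).comp (((ε : 𝕜) • B).comp (U t)) with hC_def
  have hM : ∀ t, ‖C t‖ ≤ ‖(ε : 𝕜) • B‖ := fun t => norm_conj_le hiso _ _ _
  have hCc : ∀ x, Continuous fun t => C t x := fun x =>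
    continuous_conj_apply hU.1 hiso ((ε : 𝕜) • B) continuous_neg continuous_id x
  obtain ⟨Y, hY0, hY⟩ := exists_linear_evolution hM hCc
  have hV : ∀ x t, HasDerivAt (fun s => U (-s) (U s (Y s x)))
      ((ε : 𝕜) • U (-t) (B (U t (Y t x)))) t := fun x t => by
    simp only [hU.1.apply_neg_apply]
    simpa [hC_def] using hY x t
  have hYc : ∀ x, Continuous fun t => Y t x := fun x =>
    continuous_iff_continuousAt.2 fun t => (hY x t).continuousAt
  refine ⟨fun t => (U t).comp (Y t), ⟨⟨?_, ?_, ?_⟩, ?_⟩, hV⟩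
  · ext x
    simp [hY0, hU.1.apply_zero]
  · -- Both `U(r) Y(s + r) x` and `Y(s) U(r) Y(r) x` solve the evolution equation in `s`.
    intro t r
    ext x
    have e : (fun s => U r (Y (s + r) x)) = fun s => Y s (U r (Y r x)) := by
      refine eq_of_hasDerivAt_clm hM (fun s => ?_) (hY _) (by simp [hY0])
      have h1 : HasDerivAt (fun s => Y (s + r) x) (C (s + r) (Y (s + r) x)) s := by
        simpa [Function.comp_def] using
          (hY x (s + r)).scomp s ((hasDerivAt_id' s).add_const r)
      have h2 := ((U r).restrictScalars ℝ).hasFDerivAt.comp_hasDerivAt s h1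
      refine h2.congr_deriv ?_
      change U r (U (-(s + r)) (((ε : 𝕜) • B) (U (s + r) (Y (s + r) x))))
        = U (-s) (((ε : 𝕜) • B) (U s (U r (Y (s + r) x))))
      rw [← hU.1.apply_add, ← hU.1.apply_add s r, neg_add_rev, add_neg_cancel_left]
    have e' := congrFun e t
    simp only [ContinuousLinearMap.comp_apply]
    rw [← e', ← hU.1.apply_add]
  · exact fun x => continuous_isometry_apply hU.1 hiso continuous_id (hYc x)
  · -- The difference quotients of `V` and `U` at zero differ by `U(h) ((Y(h) x - x) / h) → ε B x`.
    intro x y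
    rw [mem_graph_perturbedOperator, hU.2]
    have h1 : Tendsto (fun h : ℝ => U h (h⁻¹ • (Y h x - x))) (𝓝[≠] 0) (𝓝 ((ε : 𝕜) • B x)) := by
      have h0 := hY x 0
      rw [hasDerivAt_iff_tendsto_slope_zero] at h0
      simp only [hC_def, hY0, neg_zero, ContinuousLinearMap.comp_apply, hU.1.apply_zero, zero_add,
        smul_apply] at h0
      obtain ⟨K, hK⟩ := hU.1.exists_eventually_norm_le 0
      refine tendsto_clm_apply_of_eventually_norm_le (hK.filter_mono nhdsWithin_le_nhds) ?_ h0
      have := ((hU.1.continuous_apply ((ε : 𝕜) • B x)).tendsto 0).mono_left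
        (nhdsWithin_le_nhds (s := {0}ᶜ))
      rwa [hU.1.apply_zero] at this
    have h2 : ∀ h : ℝ, h⁻¹ • ((U h).comp (Y h) x - x)
        = h⁻¹ • (U h x - x) + U h (h⁻¹ • (Y h x - x)) := fun h => by
      rw [ContinuousLinearMap.map_smul_of_tower, ← smul_add, map_sub]
      simp
    constructor
    · intro h
      simpa only [h2, sub_add_cancel] using h.add h1
    · intro h
      simpa only [h2, add_sub_cancel_right] using h.sub h1

end Groups

/-! ### The averaging principle for linear evolution equations -/

section Averaging

variable {𝕜 X : Type*} [RCLike 𝕜] [NormedAddCommGroup X] [NormedSpace 𝕜 X]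

/-- For eventually uniformly bounded operators, convergence to zero at every vector is uniform on
compact sets of vectors. -/
theorem eventually_forall_norm_le_of_isCompact {ι : Type*} {l : Filter ι} {F : ι → ℝ → X →L[𝕜] X}
    {S : Set ℝ} {M : ℝ} (hM : ∀ᶠ i in l, ∀ s ∈ S, ‖F i s‖ ≤ M)
    (hF : ∀ x, ∀ δ > 0, ∀ᶠ i in l, ∀ s ∈ S, ‖F i s x‖ ≤ δ) {k : Set X} (hk : IsCompact k)
    {δ : ℝ} (hδ : 0 < δ) : ∀ᶠ i in l, ∀ s ∈ S, ∀ x ∈ k, ‖F i s x‖ ≤ δ := by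
  obtain ⟨t, -, htf, ht⟩ := hk.finite_cover_balls (e := δ / 2 / (|M| + 1)) (by positivity)
  filter_upwards [hM, (eventually_all_finite htf).2 fun x _ => hF x (δ / 2) (half_pos hδ)]
    with i hi hit s hs x hx
  obtain ⟨x₀, hx₀, hxx⟩ := Set.mem_iUnion₂.1 (ht hx)
  rw [mem_ball_iff_norm, lt_div_iff₀ (by positivity)] at hxx
  have h1 : ‖F i s (x - x₀)‖ ≤ δ / 2 :=
    calc _ ≤ M * ‖x - x₀‖ := (F i s).le_of_opNorm_le (hi s hs) _
      _ ≤ (|M| + 1) * ‖x - x₀‖ := by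
        gcongr
        linarith [le_abs_self M]
      _ ≤ δ / 2 := by linarith
  calc ‖F i s x‖ = ‖F i s (x - x₀) + F i s x₀‖ := by simp
    _ ≤ δ / 2 + δ / 2 := (norm_add_le _ _).trans (add_le_add h1 (hit x₀ hx₀ s hs))
    _ = δ := add_halves δ

variable [NormedSpace ℝ X]

/-- In rescaled time the interaction-picture operators have primitives converging strongly to
`s L`: up to the factor `s ≤ s₀` they are the averages over `[0, s / ε]`, and for `s / ε` bounded
the integral is short. -/
theorem IsSpectralAverage.eventually_norm_integral_le [CompleteSpace X] {U : ℝ → X →L[𝕜] X}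
    {B L : X →L[𝕜] X}
    (hU : IsStronglyContinuousGroup U) (hiso : ∀ t, Isometry (U t)) (hL : IsSpectralAverage U B L)
    {s₀ : ℝ} (hs₀ : 0 < s₀) (x : X) {δ : ℝ} (hδ : 0 < δ) :
    ∀ᶠ ε in 𝓝[>] (0 : ℝ), ∀ s ∈ Set.Icc 0 s₀,
      ‖∫ q in (0 : ℝ)..s, (U (q / ε) (B (U (-(q / ε)) x)) - L x)‖ ≤ δ := by
  set f : ℝ → X := fun t => U t (B (U (-t) x)) with hf
  have hfc : Continuous f := continuous_conj_apply hU hiso B continuous_id continuous_neg x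
  set c : ℝ := ‖B‖ * ‖x‖ + ‖L x‖ with hc
  have hc0 : 0 ≤ c := by positivity
  have hfn : ∀ t, ‖f t - L x‖ ≤ c := fun t => (norm_sub_le _ _).trans <| by
    have := ((U t).comp (B.comp (U (-t)))).le_of_opNorm_le (norm_conj_le hiso B t (-t)) x
    exact add_le_add this le_rfl
  have h1 := (tendsto_iff_norm_sub_tendsto_zero.1 (hL x)).eventually
    (gt_mem_nhds (show 0 < δ / s₀ by positivity))
  obtain ⟨T, hT⟩ := eventually_atTop.1 (h1.and (eventually_gt_atTop 0))
  have hT0 : 0 < T := (hT T le_rfl).2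
  have hsmall : ∀ᶠ ε in 𝓝[>] (0 : ℝ), ε < δ / ((c + 1) * T) :=
    nhdsWithin_le_nhds (gt_mem_nhds (by positivity))
  filter_upwards [hsmall, self_mem_nhdsWithin] with ε hε (hε0 : 0 < ε) s hs
  rcases lt_or_ge (s / ε) T with h | h
  · have h2 := intervalIntegral.norm_integral_le_of_norm_le_const (a := 0) (b := s)
      (f := fun q => f (q / ε) - L x) (C := c) fun q _ => hfn _
    rw [sub_zero, abs_of_nonneg hs.1] at h2
    rw [div_lt_iff₀ hε0] at h
    rw [lt_div_iff₀ (by positivity)] at hε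
    calc _ ≤ c * s := h2
      _ ≤ (c + 1) * (T * ε) := by gcongr; exacts [hs.1, by linarith]
      _ ≤ δ := by linarith
  · have hs0 : s ≠ 0 := by
      rintro rfl
      rw [zero_div] at h
      linarith
    have h3 : ∫ q in (0 : ℝ)..s, (f (q / ε) - L x)
        = s • ((s / ε)⁻¹ • (∫ t in (0 : ℝ)..s / ε, f t) - L x) := by
      rw [intervalIntegral.integral_sub
        (Continuous.intervalIntegrable (by fun_prop) _ _)
        (continuous_const.intervalIntegrable _ _),
        intervalIntegral.integral_comp_div f hε0.ne', intervalIntegral.integral_const, smul_sub,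
        smul_smul, zero_div, sub_zero]
      congr 2
      field_simp
    change ‖∫ q in (0 : ℝ)..s, (f (q / ε) - L x)‖ ≤ δ
    rw [h3, norm_smul, Real.norm_of_nonneg hs.1]
    calc _ ≤ s₀ * (δ / s₀) := mul_le_mul hs.2 (hT _ h).1.le (norm_nonneg _) hs₀.le
      _ = δ := by field_simp

variable [IsScalarTower ℝ 𝕜 X]

theorem exists_clm_integral {G : ℝ → X →L[𝕜] X} {M : ℝ} (hM : ∀ t, ‖G t‖ ≤ M)
    (hG : ∀ x, Continuous fun t => G t x) :
    ∃ D : ℝ → X →L[𝕜] X, (∀ s x, D s x = ∫ q in (0 : ℝ)..s, G q x) ∧ ∀ s, ‖D s‖ ≤ M * |s| := by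
  have hM0 : 0 ≤ M := (norm_nonneg _).trans (hM 0)
  have : SMulCommClass ℝ 𝕜 X := IsScalarTower.to_smulCommClass
  refine ⟨fun s => LinearMap.mkContinuous
    { toFun := fun x => ∫ q in (0 : ℝ)..s, G q x
      map_add' := fun x y => ?_
      map_smul' := fun c x => ?_ } (M * |s|) fun x => ?_, fun s x => rfl,
    fun s => LinearMap.mkContinuous_norm_le _ (by positivity) _⟩
  · simp only [map_add]
    exact intervalIntegral.integral_add ((hG x).intervalIntegrable _ _)
      ((hG y).intervalIntegrable _ _)
  · simp only [map_smul, RingHom.id_apply]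
    exact intervalIntegral.integral_smul c _
  · have := intervalIntegral.norm_integral_le_of_norm_le_const (a := 0) (b := s)
      fun q _ => (G q).le_of_opNorm_le (hM q) x
    rw [sub_zero] at this
    exact this.trans_eq (by ring)

variable [CompleteSpace X]

theorem hasDerivAt_exp_smul_apply (L : X →L[𝕜] X) (x : X) (s : ℝ) :
    HasDerivAt (fun s : ℝ => NormedSpace.exp ((s : 𝕜) • L) x)
      (L (NormedSpace.exp ((s : 𝕜) • L) x)) s := by
  have h1 := hasDerivAt_exp_smul_const' (𝕂 := 𝕜) L (s : 𝕜)
  have h2 : HasDerivAt (fun c : 𝕜 => NormedSpace.exp (c • L) x)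
      (L (NormedSpace.exp ((s : 𝕜) • L) x)) (s : 𝕜) :=
    ((ContinuousLinearMap.apply 𝕜 X x).hasFDerivAt.comp_hasDerivAt _ h1)
  have h3 := (h2.hasFDerivAt.restrictScalars ℝ).comp_hasDerivAt s
    (RCLike.ofRealCLM (K := 𝕜)).hasDerivAt
  simpa [Function.comp_def] using h3

/-- **Averaging principle.** If the strongly continuous coefficients `G i` have primitives
`∫₀ˢ G i` converging strongly to `s L`, uniformly for `s ∈ [0, s₀]`, then the solutions of
`z' = G i z` converge to the solution of `u' = L u`, uniformly on `[0, s₀]`. With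
`D(s) = ∫₀ˢ (G i - L)`, the corrected error `z - u - D u` satisfies a differential inequality with
a small inhomogeneity `G D u - D L u`. -/
theorem eventually_norm_sub_exp_le {ι : Type*} {l : Filter ι} {G : ι → ℝ → X →L[𝕜] X}
    {L : X →L[𝕜] X} {M s₀ : ℝ}
    (hG : ∀ᶠ i in l, (∀ t, ‖G i t‖ ≤ M) ∧ ∀ x, Continuous fun t => G i t x)
    (havg : ∀ x, ∀ δ > 0, ∀ᶠ i in l, ∀ s ∈ Set.Icc 0 s₀,
      ‖∫ q in (0 : ℝ)..s, (G i q x - L x)‖ ≤ δ)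
    {z : ι → ℝ → X} {y : X}
    (hz : ∀ᶠ i in l, z i 0 = y ∧ ∀ t, HasDerivAt (z i) (G i t (z i t)) t)
    {δ : ℝ} (hδ : 0 < δ) :
    ∀ᶠ i in l, ∀ s ∈ Set.Icc 0 s₀, ‖z i s - NormedSpace.exp ((s : 𝕜) • L) y‖ ≤ δ := by
  set u : ℝ → X := fun s => NormedSpace.exp ((s : 𝕜) • L) y with hu_def
  have hu : ∀ s, HasDerivAt u (L (u s)) s := hasDerivAt_exp_smul_apply L y
  have hu0 : u 0 = y := by simp [hu_def]
  have huc : Continuous u := continuous_iff_continuousAt.2 fun s => (hu s).continuousAt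
  have hD : ∀ i, ∃ D : ℝ → X →L[𝕜] X, ((∀ t, ‖G i t‖ ≤ M) ∧ ∀ x, Continuous fun t => G i t x) →
      (∀ s x, D s x = ∫ q in (0 : ℝ)..s, (G i q x - L x)) ∧
        ∀ s, ‖D s‖ ≤ (M + ‖L‖) * |s| := fun i => by
    by_cases h : (∀ t, ‖G i t‖ ≤ M) ∧ ∀ x, Continuous fun t => G i t x
    · obtain ⟨D, hD⟩ := exists_clm_integral (G := fun t => G i t - L) (M := M + ‖L‖)
        (fun t => (norm_sub_le _ _).trans (by gcongr; exact h.1 t))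
        (fun x => (h.2 x).sub continuous_const)
      exact ⟨D, fun _ => hD⟩
    · exact ⟨0, fun h' => absurd h' h⟩
  -- For the exceptional indices `i`, where `G i` need not be integrable, `D i` is zero.
  choose D hD using hD
  have hDn : ∀ᶠ i in l, ∀ s ∈ Set.Icc 0 s₀, ‖D i s‖ ≤ (M + ‖L‖) * s₀ := by
    filter_upwards [hG] with i hi s hs
    have hM0 : 0 ≤ M := (norm_nonneg _).trans (hi.1 0)
    refine ((hD i hi).2 s).trans ?_
    rw [abs_of_nonneg hs.1]
    gcongr
    exact hs.2
  have hD0 : ∀ x, ∀ δ > 0, ∀ᶠ i in l, ∀ s ∈ Set.Icc 0 s₀, ‖D i s x‖ ≤ δ := fun x δ hδ => by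
    filter_upwards [hG, havg x δ hδ] with i hi h s hs
    rw [(hD i hi).1]
    exact h s hs
  have hk : IsCompact (u '' Set.Icc 0 s₀) := isCompact_Icc.image huc
  obtain ⟨e, he, heδ⟩ : ∃ e > 0, gronwallBound 0 |M| e s₀ < δ / 2 := by
    have h := (gronwallBound_continuous_ε 0 |M| s₀).tendsto 0
    rw [gronwallBound_ε0_δ0] at h
    have := (h.mono_left (nhdsWithin_le_nhds (s := Set.Ioi 0))).eventually
      (gt_mem_nhds (half_pos hδ))
    obtain ⟨e, h1, h2⟩ := (this.and self_mem_nhdsWithin).exists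
    exact ⟨e, h2, h1⟩
  have hη : 0 < min (δ / 2) (e / (|M| + 1)) := by positivity
  filter_upwards [hG, hz, eventually_forall_norm_le_of_isCompact hDn hD0 hk hη,
    eventually_forall_norm_le_of_isCompact hDn hD0 (hk.image L.continuous) hη]
    with i hi hzi hDu hDLu s hs
  have hM0 : 0 ≤ M := (norm_nonneg _).trans (hi.1 0)
  rw [abs_of_nonneg hM0] at *
  have hDd : ∀ x t, HasDerivAt (fun s => D i s x) (G i t x - L x) t := fun x t => by
    have hc : Continuous fun q => G i q x - L x := (hi.2 x).sub continuous_const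
    exact (hc.integral_hasStrictDerivAt 0 t).hasDerivAt.congr_of_eventuallyEq
      (Eventually.of_forall fun s => (hD i hi).1 s x)
  have hDuD : ∀ t, HasDerivAt (fun s => D i s (u s))
      (G i t (u t) - L (u t) + D i t (L (u t))) t := fun t => by
    refine hasDerivAt_clm_apply_of_eventually_norm_le (K := (M + ‖L‖) * (|t| + 1)) ?_
      (hDd (u t) t) (hDd _ t).continuousAt (hu t)
    filter_upwards [continuous_abs.continuousAt.eventually_lt_const (lt_add_one |t|)] with s hs
    refine ((hD i hi).2 s).trans ?_
    gcongr
  have hg : ∀ t, HasDerivAt (fun s => z i s - u s - D i s (u s))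
      (G i t (z i t - u t - D i t (u t)) + (G i t (D i t (u t)) - D i t (L (u t)))) t := fun t => by
    refine (((hzi.2 t).sub (hu t)).sub (hDuD t)).congr_deriv ?_
    simp only [map_sub]
    abel
  have hgb := norm_le_gronwallBound_of_norm_deriv_right_le
    (f := fun s => z i s - u s - D i s (u s)) (δ := 0) (K := M) (ε := e) (a := 0) (b := s₀)
    (fun t _ => (hg t).continuousAt.continuousWithinAt) (fun t _ => (hg t).hasDerivWithinAt)
    (by simp [hzi.1, hu0, (hD i hi).1]) (fun t ht => ?_) s hs
  · have h1 : gronwallBound 0 M e (s - 0) ≤ gronwallBound 0 M e s₀ :=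
      gronwallBound_mono le_rfl he.le hM0 (by simpa using hs.2)
    have h2 := (hDu s hs (u s) ⟨s, hs, rfl⟩).trans (min_le_left _ _)
    calc ‖z i s - u s‖ = ‖(z i s - u s - D i s (u s)) + D i s (u s)‖ := by simp
      _ ≤ δ / 2 + δ / 2 := (norm_add_le _ _).trans (add_le_add (by linarith) h2)
      _ = δ := add_halves δ
  · have ht' := Set.Ico_subset_Icc_self ht
    have h1 := (hDu t ht' (u t) ⟨t, ht', rfl⟩).trans (min_le_right _ _)
    have h2 := (hDLu t ht' _ ⟨u t, ⟨t, ht', rfl⟩, rfl⟩).trans (min_le_right _ _)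
    refine (norm_add_le _ _).trans (add_le_add ((G i t).le_of_opNorm_le (hi.1 t) _) ?_)
    calc _ ≤ M * (e / (M + 1)) + e / (M + 1) :=
          (norm_sub_le _ _).trans (add_le_add (((G i t).le_of_opNorm_le (hi.1 t) _).trans
            (by gcongr)) h2)
      _ = e := by field_simp

theorem exp_smul_neg_apply_exp_smul (L : X →L[𝕜] X) (s : ℝ) (x : X) :
    NormedSpace.exp ((s : 𝕜) • -L) (NormedSpace.exp ((s : 𝕜) • L) x) = x := by
  let _ : NormedAlgebra ℚ (X →L[𝕜] X) := NormedAlgebra.restrictScalars ℚ 𝕜 _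
  have h : NormedSpace.exp ((s : 𝕜) • -L) * NormedSpace.exp ((s : 𝕜) • L) = 1 := by
    rw [← NormedSpace.exp_add_of_commute]
    · simp
    · rw [smul_neg]
      exact (Commute.refl _).neg_left
  exact DFunLike.congr_fun h x

end Averaging

/-! ### The adiabatic limit -/

section AdiabaticLimit

variable {𝕜 X : Type*} [RCLike 𝕜] [NormedAddCommGroup X] [NormedSpace 𝕜 X]
  [NormedSpace ℝ X]

/-- In rescaled time the conjugated perturbations `U(s/ε) A₁(ε) U(-s/ε)` average to `L`: replacing
`A₁(ε)` by `A₁(0)` costs at most `s₀ ‖A₁(ε) - A₁(0)‖ ‖x‖`. -/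
theorem eventually_norm_integral_conj_sub_le [CompleteSpace X] {U : ℝ → X →L[𝕜] X}
    (hU : IsStronglyContinuousGroup U) (hiso : ∀ t, Isometry (U t))
    {A₁ : ℝ → X →L[𝕜] X} (hA₁ : ContinuousAt A₁ 0) {L : X →L[𝕜] X}
    (hL : IsSpectralAverage U (A₁ 0) L)
    {s₀ : ℝ} (hs₀ : 0 < s₀) (x : X) {δ : ℝ} (hδ : 0 < δ) :
    ∀ᶠ ε in 𝓝[>] (0 : ℝ), ∀ s ∈ Set.Icc 0 s₀,
      ‖∫ q in (0 : ℝ)..s, (U (q / ε) (A₁ ε (U (-(q / ε)) x)) - L x)‖ ≤ δ := by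
  have h1 : ∀ᶠ ε in 𝓝[>] (0 : ℝ), ‖A₁ ε - A₁ 0‖ < δ / 2 / (s₀ * (‖x‖ + 1)) :=
    ((tendsto_iff_norm_sub_tendsto_zero.1 hA₁.tendsto).mono_left nhdsWithin_le_nhds).eventually
      (gt_mem_nhds (by positivity))
  filter_upwards [h1, hL.eventually_norm_integral_le hU hiso hs₀ x (half_pos hδ)] with ε hε h s hs
  have hc : ∀ B : X →L[𝕜] X, Continuous fun q => U (q / ε) (B (U (-(q / ε)) x)) := fun B =>
    continuous_conj_apply hU hiso B (by fun_prop) (by fun_prop) x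
  have hsplit : ∫ q in (0 : ℝ)..s, (U (q / ε) (A₁ ε (U (-(q / ε)) x)) - L x)
      = (∫ q in (0 : ℝ)..s, U (q / ε) ((A₁ ε - A₁ 0) (U (-(q / ε)) x)))
        + ∫ q in (0 : ℝ)..s, (U (q / ε) (A₁ 0 (U (-(q / ε)) x)) - L x) := by
    have hc' : Continuous fun q => U (q / ε) (A₁ 0 (U (-(q / ε)) x)) - L x :=
      (hc _).sub continuous_const
    rw [← intervalIntegral.integral_add ((hc _).intervalIntegrable _ _)
      (hc'.intervalIntegrable _ _)]
    congr 1
    funext q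
    simp
  have h2 := intervalIntegral.norm_integral_le_of_norm_le_const (a := 0) (b := s)
    (f := fun q => U (q / ε) ((A₁ ε - A₁ 0) (U (-(q / ε)) x))) (C := ‖A₁ ε - A₁ 0‖ * ‖x‖)
    fun q _ => ((U (q / ε)).comp ((A₁ ε - A₁ 0).comp (U (-(q / ε))))).le_of_opNorm_le
      (norm_conj_le hiso _ _ _) x
  rw [sub_zero, abs_of_nonneg hs.1] at h2
  rw [lt_div_iff₀ (by positivity)] at hε
  rw [hsplit]
  calc _ ≤ ‖A₁ ε - A₁ 0‖ * ‖x‖ * s + δ / 2 := (norm_add_le _ _).trans (add_le_add h2 (h s hs))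
    _ ≤ ‖A₁ ε - A₁ 0‖ * (‖x‖ + 1) * s₀ + δ / 2 := by
      gcongr
      exacts [hs.1, by linarith, hs.2]
    _ ≤ δ := by linarith

variable [IsScalarTower ℝ 𝕜 X]

/-- `U(-t) V(t)` is bounded by `e^{|ε| ‖B‖ |t|}`, hence so is `V(t)`, as `U(t)` is isometric. -/
theorem norm_le_exp_of_generatesGroup_perturbedOperator {A : X →ₗ.[𝕜] X} {U V : ℝ → X →L[𝕜] X}
    (hU : GeneratesGroup A U) (hiso : ∀ t, Isometry (U t)) {ε : ℝ} {B : X →L[𝕜] X}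
    (hV : GeneratesGroup (perturbedOperator A ε B) V)
    (hUV : ∀ x t, HasDerivAt (fun s => U (-s) (V s x)) ((ε : 𝕜) • U (-t) (B (V t x))) t)
    (t : ℝ) : ‖V t‖ ≤ Real.exp (|ε| * ‖B‖ * |t|) := by
  have hn : ∀ t x, ‖U t x‖ = ‖x‖ := fun t x => (hiso t).norm_map_of_map_zero (map_zero _) x
  refine ContinuousLinearMap.opNorm_le_bound _ (Real.exp_nonneg _) fun x => ?_
  have h := norm_le_exp_abs_of_hasDerivAt (M := |ε| * ‖B‖)
    (C := fun t => (U (-t)).comp (((ε : 𝕜) • B).comp (U t))) (y := fun s => U (-s) (V s x))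
    (fun t => (norm_conj_le hiso _ _ _).trans (by simp [norm_smul]))
    (fun t => by simpa [hU.1.apply_apply_neg] using hUV x t) t
  rw [hn, hn, hV.1.apply_zero] at h
  linarith

theorem eventually_forall_norm_sub_exp_le [CompleteSpace X] {A₀ : X →ₗ.[𝕜] X} {U : ℝ → X →L[𝕜] X}
    (hU : GeneratesGroup A₀ U) (hiso : ∀ t : ℝ, Isometry (U t))
    {A₁ : ℝ → X →L[𝕜] X} (hA₁ : ContinuousAt A₁ 0)
    {L : X →L[𝕜] X} (hL : IsSpectralAverage U (A₁ 0) L) {V : ℝ → ℝ → X →L[𝕜] X}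
    (hV : ∀ ε : ℝ, GeneratesGroup (perturbedOperator A₀ ε (A₁ ε)) (V ε))
    {s₀ : ℝ} (hs₀ : 0 < s₀) (x : X) {δ : ℝ} (hδ : 0 < δ) :
    ∀ᶠ ε in 𝓝[>] (0 : ℝ), ∀ s ∈ Set.Icc 0 s₀,
      ‖V ε (s / ε) (U (-(s / ε)) x) - NormedSpace.exp ((s : 𝕜) • L) x‖ ≤ δ := by
  have hUV : ∀ ε x t, HasDerivAt (fun s => U (-s) (V ε s x))
      ((ε : 𝕜) • U (-t) (A₁ ε (V ε t x))) t := fun ε => by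
    obtain ⟨W, hW, hUW⟩ := exists_generatesGroup_perturbedOperator hU hiso ε (A₁ ε)
    rwa [(hV ε).unique hW]
  have hn : ∀ t x, ‖U t x‖ = ‖x‖ := fun t x => (hiso t).norm_map_of_map_zero (map_zero _) x
  set M : ℝ := ‖A₁ 0‖ + 1 with hM_def
  have hM : ∀ᶠ ε in 𝓝[>] (0 : ℝ), ‖A₁ ε‖ ≤ M := by
    have := (hA₁.norm.tendsto.mono_left (nhdsWithin_le_nhds (s := Set.Ioi 0))).eventually
      (gt_mem_nhds (lt_add_one _))
    filter_upwards [this] with ε hε using hε.le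
  have hVn : ∀ᶠ ε in 𝓝[>] (0 : ℝ), ∀ s, |s| ≤ s₀ → ‖V ε (s / ε)‖ ≤ Real.exp (M * s₀) := by
    filter_upwards [hM, self_mem_nhdsWithin] with ε hε (hε0 : 0 < ε) s hs
    refine (norm_le_exp_of_generatesGroup_perturbedOperator hU hiso (hV ε) (hUV ε) _).trans ?_
    rw [Real.exp_le_exp, abs_div, abs_of_pos hε0]
    calc ε * ‖A₁ ε‖ * (|s| / ε) = ‖A₁ ε‖ * |s| := by field_simp
      _ ≤ M * s₀ := by gcongr
  -- `Z(s) = U(s/ε) V(-s/ε)` is the inverse of `V(s/ε) U(-s/ε)`. Each `Z(s) y`, also for `y` outside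
  -- the domain, solves the evolution equation `Z' = G Z` with bounded coefficients.
  set Z : ℝ → ℝ → X →L[𝕜] X := fun ε s => (U (s / ε)).comp (V ε (-(s / ε))) with hZ_def
  set G : ℝ → ℝ → X →L[𝕜] X := fun ε s =>
    -((U (s / ε)).comp ((A₁ ε).comp (U (-(s / ε))))) with hG_def
  have hGb : ∀ᶠ ε in 𝓝[>] (0 : ℝ), (∀ t, ‖G ε t‖ ≤ M) ∧ ∀ x, Continuous fun t => G ε t x := by
    filter_upwards [hM] with ε hε
    refine ⟨fun t => ?_, fun x => ?_⟩
    · rw [hG_def, norm_neg]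
      exact (norm_conj_le hiso _ _ _).trans hε
    · exact (continuous_conj_apply hU.1 hiso (A₁ ε) (by fun_prop) (by fun_prop) x).neg
  have havg : ∀ x, ∀ δ > 0, ∀ᶠ ε in 𝓝[>] (0 : ℝ), ∀ s ∈ Set.Icc 0 s₀,
      ‖∫ q in (0 : ℝ)..s, (G ε q x - (-L) x)‖ ≤ δ := fun x δ hδ => by
    filter_upwards [eventually_norm_integral_conj_sub_le hU.1 hiso hA₁ hL hs₀ x hδ] with ε h s hs
    refine le_of_eq_of_le ?_ (h s hs)
    rw [← norm_neg, ← intervalIntegral.integral_neg]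
    simp [hG_def, sub_eq_add_neg, add_comm]
  have hZ : ∀ y, ∀ᶠ ε in 𝓝[>] (0 : ℝ), Z ε 0 y = y ∧
      ∀ t, HasDerivAt (fun s => Z ε s y) (G ε t (Z ε t y)) t := fun y => by
    filter_upwards [self_mem_nhdsWithin] with ε (hε0 : 0 < ε)
    refine ⟨by simp [hZ_def, hU.1.apply_zero, (hV ε).1.apply_zero], fun t => ?_⟩
    have hd : HasDerivAt (fun s : ℝ => -(s / ε)) (-(1 / ε)) t :=
      ((hasDerivAt_id' t).div_const ε).neg
    have h := (hUV ε y (-(t / ε))).scomp t hd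
    simp only [Function.comp_def, neg_neg] at h
    refine h.congr_deriv ?_
    simp only [hG_def, hZ_def, ContinuousLinearMap.comp_apply, neg_apply,
      hU.1.apply_neg_apply]
    rw [neg_smul, ← algebraMap_smul 𝕜 (1 / ε), smul_smul, RCLike.algebraMap_eq_ofReal,
      ← RCLike.ofReal_mul, one_div_mul_cancel hε0.ne', RCLike.ofReal_one, one_smul]
  have hexp : ∀ (N : X →L[𝕜] X), Continuous fun s : ℝ => NormedSpace.exp ((s : 𝕜) • N) :=
    fun N => by
      let _ : NormedAlgebra ℚ (X →L[𝕜] X) := NormedAlgebra.restrictScalars ℚ 𝕜 _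
      exact NormedSpace.exp_continuous.comp (by fun_prop)
  obtain ⟨c, hc⟩ := (isCompact_Icc (a := 0) (b := s₀)).exists_bound_of_continuousOn
    (hexp (-L)).continuousOn
  have hdiff : ∀ᶠ ε in 𝓝[>] (0 : ℝ), ∀ s ∈ Set.Icc 0 s₀,
      ‖Z ε s - NormedSpace.exp ((s : 𝕜) • -L)‖ ≤ Real.exp (M * s₀) + c := by
    filter_upwards [hVn] with ε hε s hs
    refine (norm_sub_le _ _).trans (add_le_add ?_ (hc s hs))
    refine ContinuousLinearMap.opNorm_le_bound _ (Real.exp_nonneg _) fun x => ?_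
    simp only [hZ_def, ContinuousLinearMap.comp_apply, hn, ← neg_div]
    exact (V ε (-s / ε)).le_of_opNorm_le
      (hε (-s) (by rw [abs_neg, abs_of_nonneg hs.1]; exact hs.2)) x
  have hk : IsCompact ((fun s : ℝ => NormedSpace.exp ((s : 𝕜) • L) x) '' Set.Icc 0 s₀) :=
    isCompact_Icc.image ((hexp L).clm_apply continuous_const)
  have hη : 0 < δ / Real.exp (M * s₀) := by positivity
  filter_upwards [hVn, eventually_forall_norm_le_of_isCompact hdiff
    (fun y δ hδ => eventually_norm_sub_exp_le hGb havg (hZ y) hδ) hk hη] with ε hε h s hs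
  -- `V(s/ε) U(-s/ε) - e^{sL} = V(s/ε) U(-s/ε) (e^{-sL} - Z(s)) e^{sL}`
  set w := NormedSpace.exp ((s : 𝕜) • L) x with hw
  have h1 : V ε (s / ε) (U (-(s / ε)) x) - w = -V ε (s / ε) (U (-(s / ε))
      ((Z ε s - NormedSpace.exp ((s : 𝕜) • -L)) w)) := by
    rw [sub_apply, hw, exp_smul_neg_apply_exp_smul L s x]
    simp [hZ_def, hU.1.apply_neg_apply, (hV ε).1.apply_apply_neg]
  rw [h1, norm_neg]
  calc _ ≤ Real.exp (M * s₀) * ‖U (-(s / ε)) ((Z ε s - NormedSpace.exp ((s : 𝕜) • -L)) w)‖ :=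
        (V ε (s / ε)).le_of_opNorm_le (hε s (by rw [abs_of_nonneg hs.1]; exact hs.2)) _
    _ ≤ Real.exp (M * s₀) * (δ / Real.exp (M * s₀)) := by
      rw [hn]
      gcongr
      exact h s hs w ⟨s, hs, rfl⟩
    _ = δ := by field_simp

end AdiabaticLimit

theorem theorem3p1 {𝕜 X : Type*} [RCLike 𝕜] [NormedAddCommGroup X] [NormedSpace 𝕜 X]
    [NormedSpace ℝ X] [IsScalarTower ℝ 𝕜 X] [CompleteSpace X]
    (A₀ : X →ₗ.[𝕜] X) (U : ℝ → X →L[𝕜] X)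
    (hU : GeneratesGroup A₀ U) (hiso : ∀ t : ℝ, Isometry (U t))
    (A₁ : ℝ → X →L[𝕜] X) (hA₁ : Continuous A₁)
    (L : X →L[𝕜] X) (hL : IsSpectralAverage U (A₁ 0) L) :
    (∀ ε : ℝ, ∃! V : ℝ → X →L[𝕜] X, GeneratesGroup (perturbedOperator A₀ ε (A₁ ε)) V) ∧
    ∀ V : ℝ → ℝ → X →L[𝕜] X,
      (∀ ε : ℝ, GeneratesGroup (perturbedOperator A₀ ε (A₁ ε)) (V ε)) →
      ∀ s₀ : ℝ, 0 < s₀ → ∀ x : X,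
        Tendsto
          (fun ε : ℝ => ⨆ s ∈ Set.Icc (0 : ℝ) s₀,
            ‖V ε (s / ε) (U (-(s / ε)) x) - NormedSpace.exp ((s : 𝕜) • L) x‖ₑ)
          (𝓝[>] 0) (𝓝 0) := by
  refine ⟨fun ε => ?_, fun V hV s₀ hs₀ x => ?_⟩
  · obtain ⟨V, hV, -⟩ := exists_generatesGroup_perturbedOperator hU hiso ε (A₁ ε)
    exact ⟨V, hV, fun W hW => hW.unique hV⟩
  · refine ENNReal.tendsto_nhds_zero.2 fun e he => ?_
    obtain ⟨δ, hδ, hδe⟩ := ENNReal.lt_iff_exists_nnreal_btwn.1 he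
    filter_upwards [eventually_forall_norm_sub_exp_le hU hiso hA₁.continuousAt hL hV hs₀ x
      (NNReal.coe_pos.2 (ENNReal.coe_pos.1 hδ))] with ε h
    exact (iSup₂_le fun s hs => enorm_le_coe.2 (h s hs)).trans hδe.le
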